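/- Write $2^{[0,1]}$ for the collection of nonempty compact subsets of $[0,1]$. A function $f:[0,1]\to 2^{[0,1]}$ is *surjective* if every $y\in[0,1]$ lies in $f(x)$ for some $x\in[0,1]$; it is *upper semicontinuous* if for every $x$ and every open $U\supseteq f(x)$ there is an open $V\ni x$ such that $f(x')\subseteq U$ for all $x'\in V$; its *graph* is $G(f)=\{(x,y)\in[0,1]^2: y\in f(x)\}$. It has the *Weak Intermediate Value Property* if for all distinct $x_1,x_2\in[0,1]$ (in either order) and every $y_1\in f(x_1)$ there is some $y_2\in f(x_2)$ such that for every $y$ in the closed interval with endpoints $y_1,y_2$ there is some $x$ in the closed interval with endpoints $x_1,x_2$ with $y\in f(x)$. **Theorem.** For each $n\geq 1$ let $f_n:[0,1]\to 2^{[0,1]}$ be a surjective, upper semicontinuous function with a connected graph $G(f_n)$ and the Weak Intermediate Value Property. Then the generalized inverse limit $$\varprojlim\{[0,1],f_n\}=\Big\{(x_0,x_1,x_2,\dots)\in\prod_{i\geq 0}[0,1] : x_{n-1}\in f_n(x_n)\text{ for all } n\geq 1\Big\},$$ with the subspace topology from the product, is connected (and nonempty). -/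

import Mathlib

namespace SetValued

open TopologicalSpace

/-- The graph `G(f) = {(x, y) : y ∈ f x}` of `f : X → 2^Y`, where `2^Y` is the collection of
nonempty compact subsets of `Y`. -/
def graph {X Y : Type*} [TopologicalSpace Y] (f : X → NonemptyCompacts Y) : Set (X × Y) :=
  {p | p.2 ∈ f p.1}

/-- Upper semicontinuity of `f : X → 2^Y`: whenever `f x ⊆ U` with `U` open, `f x' ⊆ U` for all
`x'` near `x`. -/
def IsUSC {X Y : Type*} [TopologicalSpace X] [TopologicalSpace Y]
    (f : X → NonemptyCompacts Y) : Prop :=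
  UpperHemicontinuous fun x => (f x : Set Y)

/-- `f : X → 2^Y` is surjective if every point of `Y` belongs to some value of `f`. -/
def IsSurjective {X Y : Type*} [TopologicalSpace Y] (f : X → NonemptyCompacts Y) : Prop :=
  ∀ y : Y, ∃ x : X, y ∈ f x

/-- The Weak Intermediate Value Property. "Between" is not strict, and `x₁ < x₂` is not
required: `Set.uIcc a b` is the closed interval with endpoints `a` and `b` in either order. -/
def WeakIVP {X Y : Type*} [Lattice X] [Lattice Y] [TopologicalSpace Y]
    (f : X → NonemptyCompacts Y) : Prop :=
  ∀ x₁ x₂ : X, x₁ ≠ x₂ → ∀ y₁ ∈ f x₁, ∃ y₂ ∈ f x₂,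
    ∀ y ∈ Set.uIcc y₁ y₂, ∃ x ∈ Set.uIcc x₁ x₂, y ∈ f x

/-- The generalized inverse limit, as a subset of the product space `∏ i, X i`, of bonding
functions `f i : X (i + 1) → 2^(X i)`. -/
def inverseLimit {X : ℕ → Type*} [∀ i, TopologicalSpace (X i)]
    (f : ∀ i, X (i + 1) → NonemptyCompacts (X i)) : Set (∀ i, X i) :=
  {x | ∀ i, x i ∈ f i (x (i + 1))}

end SetValued

/-!
Write `G` for the graph of `f` and let `T` be a connected space mapping continuously onto the base
`X`. A locally constant Boolean function on the part of `G` over an interval is determined by its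
values on one fibre: by upper semicontinuity it is, near a fibre, a locally constant function of the
second coordinate alone, and the intermediate value property makes such a function take the same
values on neighbouring fibres. Given a locally constant function on the pullback `T ×_X G`,
continuing its fibres along intervals of `X` therefore has no monodromy, so it descends to `G`,
which is connected; hence the pullback is connected. Imposing the conditions `x i ∈ f i (x (i + 1))`
one at a time, with decreasing `i`, expresses each finite stage of the limit as such a pullback, and
the inverse limit is the intersection of the decreasing sequence of these compact connected stages.
-/

namespace SetValued

open Set Filter Topology TopologicalSpace

section Extension

variable {α : Type*} [TopologicalSpace α] [T2Space α]

lemma exists_isOpen_continuousOn_bool_extension {K : Set α} (hK : IsCompact K) {b : α → Bool}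
    (hb : ContinuousOn b K) :
    ∃ W, IsOpen W ∧ K ⊆ W ∧ ∃ c : α → Bool, ContinuousOn c W ∧ EqOn b c K := by
  have hcompact (v : Bool) : IsCompact (K ∩ b ⁻¹' {v}) :=
    hK.of_isClosed_subset (hb.preimage_isClosed_of_isClosed hK.isClosed (isClosed_discrete _))
      inter_subset_left
  obtain ⟨U, V, hU, hV, hKU, hKV, hUV⟩ := SeparatedNhds.of_isCompact_isCompact
    (hcompact true) (hcompact false)
    (disjoint_left.2 fun _ h h' => Bool.true_eq_false_eq_False (h.2.symm.trans h'.2))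
  have hcU : EqOn U.boolIndicator (fun _ => true) U := fun y hy => (mem_iff_boolIndicator U y).1 hy
  have hcV : EqOn U.boolIndicator (fun _ => false) V := fun y hy =>
    (notMem_iff_boolIndicator U y).1 (disjoint_right.1 hUV hy)
  have hK_or (y : α) (hy : y ∈ K) : b y = true ∧ y ∈ U ∨ b y = false ∧ y ∈ V := by
    cases h : b y
    · exact Or.inr ⟨rfl, hKV ⟨hy, h⟩⟩
    · exact Or.inl ⟨rfl, hKU ⟨hy, h⟩⟩
  refine ⟨U ∪ V, hU.union hV, fun y hy => (hK_or y hy).imp And.right And.right, U.boolIndicator,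
    (continuousOn_const.congr hcU).union_of_isOpen (continuousOn_const.congr hcV) hU hV,
    fun y hy => ?_⟩
  obtain ⟨hby, hyU⟩ | ⟨hby, hyV⟩ := hK_or y hy
  · rw [hby, hcU hyU]
  · rw [hby, hcV hyV]

lemma isConnected_iInter_of_directed {ι : Type*} [Nonempty ι] {V : ι → Set α}
    (hV : Directed (· ⊇ ·) V) (hcompact : ∀ i, IsCompact (V i))
    (hconn : ∀ i, IsConnected (V i)) : IsConnected (⋂ i, V i) := by
  have hclosed (i : ι) : IsClosed (V i) := (hcompact i).isClosed
  refine ⟨IsCompact.nonempty_iInter_of_directed_nonempty_isCompact_isClosed V hV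
    (fun i => (hconn i).nonempty) hcompact hclosed,
    isPreconnected_of_forall_constant fun b hb x hx y hy => ?_⟩
  have hcompactInter : IsCompact (⋂ i, V i) :=
    (hcompact (Classical.arbitrary ι)).of_isClosed_subset (isClosed_iInter hclosed)
      (iInter_subset _ _)
  obtain ⟨W, hW, hVW, c, hc, hbc⟩ := exists_isOpen_continuousOn_bool_extension hcompactInter hb
  obtain ⟨i, hi⟩ := exists_subset_nhds_of_isCompact hV hcompact fun z hz => hW.mem_nhds (hVW hz)
  rw [hbc hx, hbc hy]
  exact (hconn i).isPreconnected.constant (hc.mono hi) (mem_iInter.1 hx i) (mem_iInter.1 hy i)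

end Extension

section UpperSemicontinuous

variable {X Y : Type*} [TopologicalSpace X] [TopologicalSpace Y] {f : X → NonemptyCompacts Y}

lemma IsUSC.comp {T : Type*} [TopologicalSpace T] (hf : IsUSC f) {g : T → X}
    (hg : Continuous g) : IsUSC (f ∘ g) :=
  UpperHemicontinuous.comp (f := fun x => (f x : Set Y)) hf hg

lemma IsUSC.eventually_subset (hf : IsUSC f) {x : X} {W : Set Y} (hW : IsOpen W)
    (hxW : (f x : Set Y) ⊆ W) : ∀ᶠ x' in 𝓝 x, (f x' : Set Y) ⊆ W :=
  UpperHemicontinuous.forall_isOpen hf x W hW hxW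

lemma IsUSC.isClosed_graph [T3Space Y] (hf : IsUSC f) : IsClosed (graph f) :=
  isClosed_of_closure_subset fun p hp =>
    (UpperHemicontinuous.upperHemicontinuousAt hf p.1).mem_of_tendsto (f p.1).isCompact.isClosed
      (continuous_fst.tendsto p) (mem_closure_iff_frequently.1 hp) (continuous_snd.tendsto p)

lemma IsUSC.eventually_forall (hf : IsUSC f) {J : Set X} {x : X} {φ : X × Y → Prop}
    (h : ∀ y ∈ f x, ∀ᶠ q in 𝓝[graph f ∩ Prod.fst ⁻¹' J] (x, y), φ q) :
    ∀ᶠ x' in 𝓝[J] x, ∀ y ∈ f x', φ (x', y) := by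
  have htube : ∀ᶠ q in 𝓝 x ×ˢ 𝓝ˢ (f x : Set Y), q ∈ graph f ∩ Prod.fst ⁻¹' J → φ q :=
    (f x).isCompact.mem_prod_nhdsSet_of_forall fun y hy =>
      nhds_prod_eq (x := x) (y := y) ▸ eventually_nhdsWithin_iff.1 (h y hy)
  obtain ⟨p, hp, u, hu, hpu⟩ := eventually_prod_iff.1 htube
  filter_upwards [mem_nhdsWithin_of_mem_nhds hp, mem_nhdsWithin_of_mem_nhds (hf x _ hu),
    self_mem_nhdsWithin] with x' hpx' hux' hx'J y hy
  exact hpu hpx' (subset_of_mem_nhdsSet hux' hy) ⟨hy, hx'J⟩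

lemma IsUSC.exists_isOpen_continuousOn_bool [T2Space Y] (hf : IsUSC f) {J : Set X}
    {A : X × Y → Bool} (hA : ContinuousOn A (graph f ∩ Prod.fst ⁻¹' J)) {x : X} (hx : x ∈ J) :
    ∃ W, IsOpen W ∧ (f x : Set Y) ⊆ W ∧ ∃ c : Y → Bool, ContinuousOn c W ∧
      ∀ᶠ x' in 𝓝[J] x, ∀ y ∈ f x', A (x', y) = c y := by
  have hfibre : ContinuousOn (fun y => A (x, y)) (f x) :=
    hA.comp (Continuous.prodMk_right x).continuousOn fun y hy => ⟨hy, hx⟩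
  obtain ⟨W, hW, hxW, c, hc, hAc⟩ :=
    exists_isOpen_continuousOn_bool_extension (f x).isCompact hfibre
  refine ⟨W, hW, hxW, c, hc, hf.eventually_forall (φ := fun q => A q = c q.2) fun y hy => ?_⟩
  have hpair : ContinuousWithinAt (fun q : X × Y => (A q, c q.2))
      (graph f ∩ Prod.fst ⁻¹' J) (x, y) :=
    (hA (x, y) ⟨hy, hx⟩).prodMk
      ((hc.continuousAt (hW.mem_nhds (hxW hy))).comp_continuousWithinAt continuousWithinAt_snd)
  exact hpair.preimage_mem_nhdsWithin
    ((isOpen_discrete {b : Bool × Bool | b.1 = b.2}).mem_nhds (hAc hy))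

end UpperSemicontinuous

section WeakIVP

variable {X Y : Type*} [LinearOrder X] [TopologicalSpace X] [OrderTopology X]
  [ConditionallyCompleteLinearOrder Y] [DenselyOrdered Y] [TopologicalSpace Y] [OrderTopology Y]
  {f : X → NonemptyCompacts Y}

lemma WeakIVP.eventually_exists_eq (hw : WeakIVP f) (hf : IsUSC f) {x : X} {W : Set Y}
    (hW : IsOpen W) (hxW : (f x : Set Y) ⊆ W) {c : Y → Bool} (hc : ContinuousOn c W) {y : Y}
    (hy : y ∈ f x) : ∀ᶠ x' in 𝓝 x, ∃ y' ∈ f x', c y' = c y := by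
  have hsegment : ∀ᶠ x' in 𝓝 x, uIcc x x' ⊆ {w | (f w : Set Y) ⊆ W} :=
    tendsto_smallSets_iff.1 (tendsto_const_nhds.uIcc tendsto_id) _ (hf.eventually_subset hW hxW)
  filter_upwards [hsegment] with x' hx'
  obtain rfl | hne := eq_or_ne x x'
  · exact ⟨y, hy, rfl⟩
  obtain ⟨y', hy', hcover⟩ := hw x x' hne y hy
  have huIccW : uIcc y y' ⊆ W := fun z hz =>
    let ⟨_, hwx, hzw⟩ := hcover z hz
    hx' hwx hzw
  exact ⟨y', hy',
    isPreconnected_uIcc.constant (hc.mono huIccW) right_mem_uIcc left_mem_uIcc⟩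

lemma WeakIVP.eventually_exists_eq_iff (hw : WeakIVP f) (hf : IsUSC f) {J : Set X}
    {A : X × Y → Bool} (hA : ContinuousOn A (graph f ∩ Prod.fst ⁻¹' J)) (v : Bool) {x : X}
    (hx : x ∈ J) :
    ∀ᶠ x' in 𝓝[J] x, (∃ y' ∈ f x', A (x', y') = v) ↔ ∃ y ∈ f x, A (x, y) = v := by
  obtain ⟨W, hW, hxW, c, hc, hAc⟩ := hf.exists_isOpen_continuousOn_bool hA hx
  have hAcx : ∀ y ∈ f x, A (x, y) = c y := hAc.self_of_nhdsWithin hx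
  by_cases hv : ∃ y ∈ f x, A (x, y) = v
  · obtain ⟨y, hy, rfl⟩ := hv
    filter_upwards [hAc, mem_nhdsWithin_of_mem_nhds (hw.eventually_exists_eq hf hW hxW hc hy)]
      with x' hAc' ⟨y', hy', hcy⟩
    exact iff_of_true ⟨y', hy', by rw [hAc' y' hy', hAcx y hy, hcy]⟩ ⟨y, hy, rfl⟩
  · have hxW' : (f x : Set Y) ⊆ W ∩ c ⁻¹' {v}ᶜ := fun y hy =>
      ⟨hxW hy, fun hcy => hv ⟨y, hy, (hAcx y hy).trans hcy⟩⟩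
    filter_upwards [hAc, mem_nhdsWithin_of_mem_nhds
      (hf.eventually_subset (hc.isOpen_inter_preimage hW (isOpen_discrete _)) hxW')]
      with x' hAc' hx'W
    exact iff_of_false (fun ⟨y', hy', hAv⟩ => (hx'W hy').2 ((hAc' y' hy').symm.trans hAv)) hv

lemma WeakIVP.eq_of_eq_on_fibre (hw : WeakIVP f) (hf : IsUSC f) {J : Set X}
    (hJ : IsPreconnected J) {A B : X × Y → Bool}
    (hA : ContinuousOn A (graph f ∩ Prod.fst ⁻¹' J))
    (hB : ContinuousOn B (graph f ∩ Prod.fst ⁻¹' J)) {x₀ : X} (hx₀ : x₀ ∈ J)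
    (h₀ : ∀ y ∈ f x₀, A (x₀, y) = B (x₀, y)) {x : X} (hx : x ∈ J) {y : Y} (hy : y ∈ f x) :
    A (x, y) = B (x, y) := by
  have hne : ContinuousOn (fun p => A p ^^ B p) (graph f ∩ Prod.fst ⁻¹' J) :=
    (continuous_of_discreteTopology (f := fun b : Bool × Bool => b.1 ^^ b.2)).comp_continuousOn
      (hA.prodMk hB)
  have hiff : (∃ z ∈ f x₀, (A (x₀, z) ^^ B (x₀, z)) = true) ↔
      ∃ z ∈ f x, (A (x, z) ^^ B (x, z)) = true :=
    hJ.induction₂'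
      (fun a b => (∃ z ∈ f a, (A (a, z) ^^ B (a, z)) = true) ↔
        ∃ z ∈ f b, (A (b, z) ^^ B (b, z)) = true)
      (fun a ha => (hw.eventually_exists_eq_iff hf hne true ha).mono fun _ h => ⟨h.symm, h⟩)
      (fun _ _ _ _ _ _ => Iff.trans) hx₀ hx
  by_contra hAB
  obtain ⟨z, hz, hzne⟩ := hiff.2 ⟨y, hy, bne_iff_ne.2 hAB⟩
  exact bne_iff_ne.1 hzne (h₀ z hz)

end WeakIVP

section Continuation

variable {X Y : Type*}

/-- `IsContinuation f x b x' b'` says that `b'` on the fibre `f x'` is the continuation of `b` on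
the fibre `f x` along the interval between `x` and `x'`: both are restrictions of one locally
constant function on the part of the graph over that interval. -/
def IsContinuation [Lattice X] [TopologicalSpace X] [TopologicalSpace Y]
    (f : X → NonemptyCompacts Y) (x : X) (b : Y → Bool) (x' : X) (b' : Y → Bool) : Prop :=
  ∃ Q : X × Y → Bool, ContinuousOn Q (graph f ∩ Prod.fst ⁻¹' uIcc x x') ∧
    (∀ y ∈ f x, Q (x, y) = b y) ∧ ∀ y ∈ f x', Q (x', y) = b' y

lemma IsContinuation.symm [Lattice X] [TopologicalSpace X] [TopologicalSpace Y]
    {f : X → NonemptyCompacts Y} {x x' : X} {b b' : Y → Bool} (h : IsContinuation f x b x' b') :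
    IsContinuation f x' b' x b :=
  let ⟨Q, hQ, hb, hb'⟩ := h
  ⟨Q, uIcc_comm x x' ▸ hQ, hb', hb⟩

lemma IsUSC.eventually_isContinuation [LinearOrder X] [TopologicalSpace X] [OrderTopology X]
    [TopologicalSpace Y] [T2Space Y] {f : X → NonemptyCompacts Y} (hf : IsUSC f) {T : Type*}
    [TopologicalSpace T] {g : T → X} (hg : Continuous g) {A : T × Y → Bool}
    (hA : ContinuousOn A (graph (f ∘ g))) (t : T) :
    ∀ᶠ t' in 𝓝 t,
      IsContinuation f (g t) (fun y => A (t, y)) (g t') fun y => A (t', y) := by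
  obtain ⟨W, hW, htW, c, hc, hAc⟩ := (hf.comp hg).exists_isOpen_continuousOn_bool
    (hA.mono inter_subset_left) (mem_univ t)
  rw [nhdsWithin_univ] at hAc
  have hsegment : ∀ᶠ t' in 𝓝 t, uIcc (g t) (g t') ⊆ {x | (f x : Set Y) ⊆ W} :=
    tendsto_smallSets_iff.1 (tendsto_const_nhds.uIcc hg.continuousAt) _
      (hf.eventually_subset hW htW)
  filter_upwards [hAc, hsegment] with t' hAc' ht'
  exact ⟨fun p => c p.2, hc.comp continuousOn_snd fun p hp => ht' hp.2 hp.1,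
    fun y hy => (hAc.self_of_nhds y hy).symm, fun y hy => (hAc' y hy).symm⟩

variable [ConditionallyCompleteLinearOrder X] [DenselyOrdered X] [TopologicalSpace X]
  [OrderTopology X] [ConditionallyCompleteLinearOrder Y] [DenselyOrdered Y] [TopologicalSpace Y]
  [OrderTopology Y] {f : X → NonemptyCompacts Y}

lemma IsContinuation.trans (hw : WeakIVP f) (hf : IsUSC f) {x₁ x₂ x₃ : X} {b₁ b₂ b₃ : Y → Bool}
    (h₁₂ : IsContinuation f x₁ b₁ x₂ b₂) (h₂₃ : IsContinuation f x₂ b₂ x₃ b₃) :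
    IsContinuation f x₁ b₁ x₃ b₃ := by
  classical
  obtain ⟨Q, hQ, hQ₁, hQ₂⟩ := h₁₂
  obtain ⟨R, hR, hR₂, hR₃⟩ := h₂₃
  have hoverlap : ∀ x ∈ uIcc x₁ x₂ ∩ uIcc x₂ x₃, ∀ y ∈ f x, Q (x, y) = R (x, y) :=
    fun x hx y hy => hw.eq_of_eq_on_fibre hf
      (ordConnected_uIcc.inter ordConnected_uIcc).isPreconnected
      (hQ.mono (inter_subset_inter_right _ (preimage_mono inter_subset_left)))
      (hR.mono (inter_subset_inter_right _ (preimage_mono inter_subset_right)))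
      ⟨right_mem_uIcc, left_mem_uIcc⟩ (fun z hz => (hQ₂ z hz).trans (hR₂ z hz).symm) hx hy
  let P : X × Y → Bool := fun p => if p.1 ∈ uIcc x₁ x₂ then Q p else R p
  have hPQ : EqOn P Q (graph f ∩ Prod.fst ⁻¹' uIcc x₁ x₂) := fun p hp => if_pos hp.2
  have hPR : EqOn P R (graph f ∩ Prod.fst ⁻¹' uIcc x₂ x₃) := fun p hp => by
    by_cases hp₁ : p.1 ∈ uIcc x₁ x₂
    · exact (if_pos hp₁).trans (hoverlap p.1 ⟨hp₁, hp.2⟩ p.2 hp.1)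
    · exact if_neg hp₁
  have hclosed (a b : X) : IsClosed (graph f ∩ Prod.fst ⁻¹' uIcc a b) :=
    hf.isClosed_graph.inter (isClosed_Icc.preimage continuous_fst)
  refine ⟨P, ((hQ.congr hPQ).union_of_isClosed (hR.congr hPR) (hclosed _ _) (hclosed _ _)).mono ?_,
    fun y hy => (hPQ ⟨hy, left_mem_uIcc⟩).trans (hQ₁ y hy),
    fun y hy => (hPR ⟨hy, right_mem_uIcc⟩).trans (hR₃ y hy)⟩
  rw [← inter_union_distrib_left, ← preimage_union]
  exact inter_subset_inter_right _ (preimage_mono uIcc_subset_uIcc_union_uIcc)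

lemma WeakIVP.isContinuation (hw : WeakIVP f) (hf : IsUSC f) {T : Type*} [TopologicalSpace T]
    [PreconnectedSpace T] {g : T → X} (hg : Continuous g) {A : T × Y → Bool}
    (hA : ContinuousOn A (graph (f ∘ g))) (t t' : T) :
    IsContinuation f (g t) (fun y => A (t, y)) (g t') fun y => A (t', y) :=
  PreconnectedSpace.induction₂'
    (fun t t' => IsContinuation f (g t) (fun y => A (t, y)) (g t') fun y => A (t', y))
    (fun t => (hf.eventually_isContinuation hg hA t).mono fun _ h => ⟨h, h.symm⟩)
    ⟨fun _ _ _ => IsContinuation.trans hw hf⟩ t t'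

end Continuation

section Pullback

variable {X Y : Type*} [CompleteLinearOrder X] [DenselyOrdered X] [TopologicalSpace X]
  [OrderTopology X] [ConditionallyCompleteLinearOrder Y] [DenselyOrdered Y] [TopologicalSpace Y]
  [OrderTopology Y] {f : X → NonemptyCompacts Y} {T : Type*} [TopologicalSpace T]
  [PreconnectedSpace T] {g : T → X}

lemma WeakIVP.exists_continuousOn_graph_eq_comp (hw : WeakIVP f) (hf : IsUSC f)
    (hg : Continuous g) (hgs : Function.Surjective g) {A : T × Y → Bool}
    (hA : ContinuousOn A (graph (f ∘ g))) :
    ∃ Q : X × Y → Bool, ContinuousOn Q (graph f) ∧ ∀ t, ∀ y ∈ f (g t), A (t, y) = Q (g t, y) := by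
  obtain ⟨t₀, ht₀⟩ := hgs ⊥
  obtain ⟨t₁, ht₁⟩ := hgs ⊤
  obtain ⟨Q, hQ, hQ₀, -⟩ := hw.isContinuation hf hg hA t₀ t₁
  have hgraph : ContinuousOn Q (graph f) := by simpa [ht₀, ht₁] using hQ
  refine ⟨Q, hgraph, fun t y hy => ?_⟩
  obtain ⟨R, hR, hR₀, hRt⟩ := hw.isContinuation hf hg hA t₀ t
  refine (hRt y hy).symm.trans ?_
  exact hw.eq_of_eq_on_fibre hf isPreconnected_uIcc hR (hgraph.mono inter_subset_left)
    left_mem_uIcc (fun z hz => (hR₀ z hz).trans (hQ₀ z hz).symm) right_mem_uIcc hy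

lemma WeakIVP.isPreconnected_graph_comp (hw : WeakIVP f) (hf : IsUSC f)
    (hG : IsPreconnected (graph f)) (hg : Continuous g) (hgs : Function.Surjective g) :
    IsPreconnected (graph (f ∘ g)) := by
  refine isPreconnected_of_forall_constant fun A hA => ?_
  obtain ⟨Q, hQ, hAQ⟩ := hw.exists_continuousOn_graph_eq_comp hf hg hgs hA
  rintro ⟨t, y⟩ hy ⟨t', y'⟩ hy'
  rw [hAQ t y hy, hAQ t' y' hy']
  exact hG.constant hQ (x := (g t, y)) (y := (g t', y')) hy hy'

end Pullback

section InverseLimit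

variable {X : ℕ → Type*} [∀ i, TopologicalSpace (X i)] {f : ∀ i, X (i + 1) → NonemptyCompacts (X i)}

/-- The sequences satisfying the conditions of the inverse limit with index in `[k, n)`. All
coordinates are kept, those outside `[k, n]` being unconstrained, so that the stages for
different `k` and `n` are subsets of one space. -/
def partialLimit (f : ∀ i, X (i + 1) → NonemptyCompacts (X i)) (k n : ℕ) : Set (∀ i, X i) :=
  {x | ∀ i ∈ Ico k n, x i ∈ f i (x (i + 1))}

lemma partialLimit_anti (k : ℕ) : Antitone (partialLimit f k) :=
  fun _ _ hmn _ hx i hi => hx i (Ico_subset_Ico_right hmn hi)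

lemma partialLimit_self (n : ℕ) : partialLimit f n n = univ :=
  eq_univ_of_forall fun _ _ hi => absurd hi (by simp)

lemma iInter_partialLimit_zero : ⋂ n, partialLimit f 0 n = inverseLimit f := by
  ext x
  exact mem_iInter.trans ⟨fun h i => h (i + 1) i ⟨i.zero_le, i.lt_succ_self⟩, fun h _ i _ => h i⟩

lemma isClosed_partialLimit [∀ i, T3Space (X i)] (hf : ∀ i, IsUSC (f i)) (k n : ℕ) :
    IsClosed (partialLimit f k n) := by
  have heq : partialLimit f k n =
      ⋂ i ∈ Ico k n, (fun x : ∀ i, X i => (x (i + 1), x i)) ⁻¹' graph (f i) := by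
    ext x
    simp only [mem_iInter]
    rfl
  rw [heq]
  exact isClosed_biInter fun i _ => (hf i).isClosed_graph.preimage (by fun_prop)

lemma update_mem_partialLimit {k n : ℕ} {x : ∀ i, X i} (hx : x ∈ partialLimit f (k + 1) n)
    {y : X k} (hy : y ∈ f k (x (k + 1))) : Function.update x k y ∈ partialLimit f k n := by
  rintro i ⟨hki, hin⟩
  obtain rfl | hki := hki.eq_or_lt
  · simpa using hy
  · rw [Function.update_of_ne hki.ne', Function.update_of_ne (by omega)]
    exact hx i ⟨hki, hin⟩

lemma exists_mem_partialLimit_apply_eq [∀ i, Nonempty (X i)] (hs : ∀ i, IsSurjective (f i))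
    {k n : ℕ} (hkn : k ≤ n) : ∀ a : X k, ∃ x ∈ partialLimit f k n, x k = a := by
  induction hkn using Nat.decreasingInduction with
  | self =>
    intro a
    rw [partialLimit_self]
    exact ⟨Function.update (fun i => Classical.arbitrary (X i)) n a, mem_univ _, by simp⟩
  | of_succ k _ ih =>
    intro a
    obtain ⟨b, hab⟩ := hs k a
    obtain ⟨x, hx, rfl⟩ := ih b
    exact ⟨Function.update x k a, update_mem_partialLimit hx hab, by simp⟩

lemma image_update_graph {k n : ℕ} (hkn : k < n) :
    (fun p : partialLimit f (k + 1) n × X k => Function.update p.1.1 k p.2) ''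
      graph (f k ∘ fun x : partialLimit f (k + 1) n => x.1 (k + 1)) = partialLimit f k n := by
  ext x
  constructor
  · rintro ⟨p, hp, rfl⟩
    exact update_mem_partialLimit p.1.2 hp
  · exact fun hx => ⟨(⟨x, fun i hi => hx i ⟨k.le_succ.trans hi.1, hi.2⟩⟩, x k),
      hx k ⟨le_rfl, hkn⟩, Function.update_eq_self k x⟩

end InverseLimit

section Connected

variable {X : ℕ → Type*} [∀ i, CompleteLinearOrder (X i)] [∀ i, DenselyOrdered (X i)]
  [∀ i, TopologicalSpace (X i)] [∀ i, OrderTopology (X i)]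
  {f : ∀ i, X (i + 1) → NonemptyCompacts (X i)}

lemma isConnected_partialLimit (hsurj : ∀ i, IsSurjective (f i)) (husc : ∀ i, IsUSC (f i))
    (hgraph : ∀ i, IsPreconnected (graph (f i))) (hwivp : ∀ i, WeakIVP (f i)) {k n : ℕ}
    (hkn : k ≤ n) : IsConnected (partialLimit f k n) := by
  induction hkn using Nat.decreasingInduction with
  | self =>
    rw [partialLimit_self]
    exact ⟨univ_nonempty, isPreconnected_univ⟩
  | of_succ k hkn ih =>
    obtain ⟨x, hx, -⟩ := exists_mem_partialLimit_apply_eq hsurj hkn.le (⊥ : X k)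
    have : PreconnectedSpace (partialLimit f (k + 1) n) :=
      Subtype.preconnectedSpace ih.isPreconnected
    have hcont : Continuous fun x : partialLimit f (k + 1) n => x.1 (k + 1) :=
      (continuous_apply (k + 1)).comp continuous_subtype_val
    have hsurj_apply : Function.Surjective fun x : partialLimit f (k + 1) n => x.1 (k + 1) :=
      fun a =>
        let ⟨x, hx, hxa⟩ := exists_mem_partialLimit_apply_eq hsurj (Nat.succ_le_of_lt hkn) a
        ⟨⟨x, hx⟩, hxa⟩
    have hpullback := (hwivp k).isPreconnected_graph_comp (husc k) (hgraph k) hcont hsurj_apply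
    refine ⟨⟨x, hx⟩, image_update_graph (f := f) hkn ▸ hpullback.image _ ?_⟩
    exact ((continuous_subtype_val.comp continuous_fst).update k continuous_snd).continuousOn

end Connected

end SetValued

open SetValued in
theorem theorem3p6_general {X : ℕ → Type*} [∀ i, CompleteLinearOrder (X i)]
    [∀ i, DenselyOrdered (X i)] [∀ i, TopologicalSpace (X i)] [∀ i, OrderTopology (X i)]
    {f : ∀ i, X (i + 1) → TopologicalSpace.NonemptyCompacts (X i)}
    (hsurj : ∀ i, IsSurjective (f i)) (husc : ∀ i, IsUSC (f i))
    (hgraph : ∀ i, IsPreconnected (graph (f i))) (hwivp : ∀ i, WeakIVP (f i)) :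
    IsConnected (inverseLimit f) := by
  rw [← iInter_partialLimit_zero]
  exact isConnected_iInter_of_directed (partialLimit_anti 0).directed_ge
    (fun n => (isClosed_partialLimit husc 0 n).isCompact)
    fun n => isConnected_partialLimit hsurj husc hgraph hwivp n.zero_le

theorem theorem3p6
    (f : ℕ → unitInterval → TopologicalSpace.NonemptyCompacts unitInterval)
    (hsurj : ∀ n, SetValued.IsSurjective (f n))
    (husc : ∀ n, SetValued.IsUSC (f n))
    (hgraph : ∀ n, IsConnected (SetValued.graph (f n)))
    (hwivp : ∀ n, SetValued.WeakIVP (f n)) :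
    IsConnected (SetValued.inverseLimit (X := fun _ => unitInterval) f) :=
  theorem3p6_general hsurj husc (fun n => (hgraph n).isPreconnected) hwivp
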